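/- Definitions. Let $X$ be a set, $n\ge 0$, and $\mathcal H$ a class of functions $X\to\mathbb R^n$. *ADL.* For a distribution $\mathcal D$ on $X$, a $(1,b)$-compressor for $(\mathcal H,\mathcal D)$ consists of a probability space $(\Omega,\mu)$, an encoder $E:\Omega\times\mathcal H\to\{0,1\}^*$ and a decoder $D:\{0,1\}^*\to(\mathbb R^n)^X$ such that for every $h\in\mathcal H$ the random function $\hat h=D(E(\omega,h))$ satisfies $\mathbb E_\omega\hat h(x)=h(x)$ for all $x$ and $\mathbb E_{x\sim\mathcal D}\mathbb E_\omega\langle u,\hat h(x)-h(x)\rangle^2\le 1$ for every Euclidean unit vector $u\in\mathbb R^n$, and $\mathbb E_\omega\,\mathrm{len}(E(\omega,h))\le b$. $\mathrm{ADL}(\mathcal H)\in[0,\infty]$ is the infimum of the $b\in[0,\infty)$ such that for every finite $A\subset X$ and every distribution $\mathcal D$ on $A$ there is a $(1,b)$-compressor for $(\mathcal H|_A,\mathcal D)$. *Covering numbers.* For a norm $\|\cdot\|_L$ on $\mathbb R^n$, an integer $m\ge 0$ and $\varepsilon>0$, $\mathcal N_L(\mathcal H,m,\varepsilon)$ is the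 least $N$ such that for every $A\subset X$ with $|A|\le m$ there are at most $N$ functions $X\to\mathbb R^n$ such that every $h\in\mathcal H$ has one of them, $\tilde h$, with $\frac1{|A|}\sum_{x\in A}\|h(x)-\tilde h(x)\|_L^2\le\varepsilon^2$ (no condition if $A=\emptyset$). A set $\mathcal H\subset\mathbb R^n$ is regarded as a class of functions from a one-point space to $\mathbb R^n$, and then $\mathcal N_L(\mathcal H,\varepsilon)=\mathcal N_L(\mathcal H,1,\varepsilon)$. Logarithms are to base $2$. Theorem. For every constant $C$ there is $d_0$ such that the following holds for every integer $d\ge d_0$, with $n=d^4$. Let $\|\cdot\|_L$ be any norm on $\mathbb R^n$ such that, for every class $\mathcal H$ of functions from any set $X$ to $\mathbb R^n$ with $\mathrm{ADL}(\mathcal H)=a<\infty$, every $m$ and every $0<\varepsilon\le 1$, $$\log\mathcal N_L(\mathcal H,m,\varepsilon)\le \frac{C\,a}{\varepsilon^2}.$$ Then there is a set $\mathcal H\subset[0,1]^n$ such that $\log\mathcal N_L(\mathcal H,\varepsilon)\le\frac1{\varepsilon^2}$ for every $\varepsilon>0$, yet $\mathrm{ADL}(\mathcal H)\ge d$. -/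

import Mathlib

open MeasureTheory
open scoped ENNReal NNReal

/-- Euclidean space `ℝⁿ`. -/
abbrev Euc (n : ℕ) : Type := EuclideanSpace ℝ (Fin n)

/-- The random function `F : Ω → X → ℝⁿ` on the probability space `(Ω, μ)` is a `σ`-estimator of
`f : X → ℝⁿ` under the (discrete) distribution `𝒟` on `X`: it is unbiased at every point, and in
every direction `u` of the unit sphere its mean squared error is at most `σ ^ 2`. -/
structure IsEstimator {X Ω : Type} {n : ℕ} [MeasurableSpace Ω] (σ : ℝ) (μ : Measure Ω)
    (𝒟 : PMF X) (F : Ω → X → Euc n) (f : X → Euc n) : Prop where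
  integrable : ∀ x, Integrable (fun ω => F ω x) μ
  unbiased : ∀ x, ∫ ω, F ω x ∂μ = f x
  error_le : ∀ u : Euc n, ‖u‖ = 1 →
    ∑' x, 𝒟 x * ∫⁻ ω, ENNReal.ofReal (inner ℝ u (F ω x - f x) ^ 2) ∂μ ≤ ENNReal.ofReal (σ ^ 2)

/-- A `(σ, b)`-compressor for `(H, 𝒟)`: a probability space `(Ω, μ)`, a randomized encoder of the
members of `H` by finite bit strings and a deterministic decoder, such that decoding the random code
of `h` is a `σ`-estimator of `h`, and the expected code length is at most `b`, for every `h ∈ H`. -/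
structure Compressor {X : Type} {n : ℕ} (σ : ℝ) (b : ℝ≥0) (H : Set (X → Euc n)) (𝒟 : PMF X) where
  Ω : Type
  [mΩ : MeasurableSpace Ω]
  μ : Measure Ω
  isProb : IsProbabilityMeasure μ
  enc : Ω → H → List Bool
  dec : List Bool → X → Euc n
  enc_measurable : ∀ (h : H) (w : List Bool), MeasurableSet {ω | enc ω h = w}
  estimator : ∀ h : H, IsEstimator σ μ 𝒟 (fun ω => dec (enc ω h)) h
  length_le : ∀ h : H, ∫⁻ ω, ((enc ω h).length : ℝ≥0∞) ∂μ ≤ b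

/-- The restriction `H|_A` of a class of functions to a finite set `A`. -/
def restrictClass {X : Type} {n : ℕ} (H : Set (X → Euc n)) (A : Finset X) : Set (A → Euc n) :=
  (fun h (x : A) => h x) '' H

/-- `H` has approximate description length `b m`: for every `A` of size at most `m` and every
distribution `𝒟` on `A` there is a `(1, b m)`-compressor for `(H|_A, 𝒟)`. -/
def HasADL {X : Type} {n : ℕ} (H : Set (X → Euc n)) (b : ℕ → ℝ≥0) : Prop :=
  ∀ (m : ℕ) (A : Finset X), A.card ≤ m → ∀ 𝒟 : PMF A,
    Nonempty (Compressor 1 (b m) (restrictClass H A) 𝒟)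

/-- `ADL(H)`: the infimum of the numbers `b` such that `H` has approximate description length `b`
for all sample sizes (`∞` if there is none). -/
noncomputable def ADL {X : Type} {n : ℕ} (H : Set (X → Euc n)) : ℝ≥0∞ :=
  ⨅ (b : ℝ≥0) (_ : HasADL H (fun _ => b)), (b : ℝ≥0∞)

/-- The covering number `N_L(H, m, ε)` with respect to a norm `L` on `ℝⁿ`: the least `N` such that
for every `A` of size at most `m` there are at most `N` functions such that each `h ∈ H` is
`ε`-close to one of them in the `L²` mean of the `L`-distance over `A`. -/
noncomputable def coveringNumber {X : Type} {n : ℕ} (L : Seminorm ℝ (Euc n))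
    (H : Set (X → Euc n)) (m : ℕ) (ε : ℝ) : ℕ∞ :=
  sInf {N : ℕ∞ | ∀ A : Finset X, A.card ≤ m → ∃ T : Set (X → Euc n), T.encard ≤ N ∧
    ∀ h ∈ H, ∃ g ∈ T, (∑ x ∈ A, L (h x - g x) ^ 2) / (A.card : ℝ) ≤ ε ^ 2}

/-- Base-two logarithm of an extended natural number (`log₂ ∞ = ∞`). -/
noncomputable def log₂ : ℕ∞ → EReal
  | ⊤ => ⊤
  | (N : ℕ) => ((Real.logb 2 (N : ℝ) : ℝ) : EReal)

/-- A set `S ⊆ ℝⁿ` regarded as a class of functions from a one-point space to `ℝⁿ`. -/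
def pointClass {n : ℕ} (S : Set (Euc n)) : Set (Unit → Euc n) :=
  (fun v _ => v) '' S

/-! The set `S` consists of the vertices of a parallelepiped with k = 16d orthogonal edge
directions, inside the unit cube, long in the Euclidean norm but short in L. Independent randomized
rounding describes a point of the cube with n bits, so the cube has ADL at most n
(`hasADL_unitCube`), and the hypothesis on L at ε = 1 covers it by at most 2^(mn) L-balls of radius
1, where m ≥ |C|. A grid of side J = Q² has far more points than that. By pigeonhole, two grid
points share a ball, have equal inner products with all differences already chosen, and differ in
more than n/2 coordinates. Iterating gives k orthogonal integer differences z with L(z) ≤ 2J and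
|z|² ≥ n/2 (`exists_orthogonal_intVec`). Scaled by 1/(2Jk√k), they span a box of L-radius at most
1/√k with 2^k vertices: one centre suffices for ε ≥ 1/√k, and all vertices, with k ≤ 1/ε², otherwise
(`log₂_coveringNumber_parVertex_le`). The squared Euclidean lengths are at least of order n/(J²k³),
hence of order d/J² for n = d⁴, so they exceed 32 for large d. A compressor with unit error must
then reveal most of the k signs, which takes d bits (`le_ADL_parVertex`). -/

/-! ### Hamming balls and pigeonhole on a grid. -/

theorem sum_pow_hammingDist {ι α : Type*} [Fintype ι] [DecidableEq ι] [Fintype α] [DecidableEq α]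
    (x : ι → α) (t : ℝ) :
    ∑ y : ι → α, t ^ hammingDist x y =
      (1 + ((Fintype.card α : ℝ) - 1) * t) ^ Fintype.card ι := by
  have h1 : ∀ y : ι → α, t ^ hammingDist x y = ∏ i, (if x i = y i then 1 else t) := by
    intro y
    rw [hammingDist, ← Finset.prod_const, Finset.prod_filter]
    refine Finset.prod_congr rfl fun i _ => ?_
    by_cases h : x i = y i <;> simp [h]
  have h2 : ∀ i, ∑ a, (if x i = a then (1 : ℝ) else t) = 1 + ((Fintype.card α : ℝ) - 1) * t := by
    intro i
    have : ∀ a, (if x i = a then (1 : ℝ) else t) = (if x i = a then (1 - t) else 0) + t := by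
      intro a
      split_ifs <;> ring
    simp_rw [this, Finset.sum_add_distrib, Finset.sum_ite_eq]
    simp
    ring
  simp_rw [h1]
  have h3 := Finset.prod_univ_sum (fun _ : ι => (Finset.univ : Finset α))
    (fun i a => if x i = a then (1 : ℝ) else t)
  rw [Fintype.piFinset_univ] at h3
  rw [← h3]
  simp [h2]

/-- Chernoff-type bound on the size of a Hamming ball. -/
theorem card_hammingBall_mul_pow_le {ι α : Type*} [Fintype ι] [DecidableEq ι] [Fintype α]
    [DecidableEq α] (x : ι → α) {t : ℝ} (h0 : 0 ≤ t) (h1 : t ≤ 1) (r : ℕ) :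
    ((Finset.univ.filter fun y : ι → α => hammingDist x y ≤ r).card : ℝ) * t ^ r ≤
      (1 + ((Fintype.card α : ℝ) - 1) * t) ^ Fintype.card ι := by
  rw [← sum_pow_hammingDist x t, ← nsmul_eq_mul]
  refine (Finset.card_nsmul_le_sum _ (fun y => t ^ hammingDist x y) _ fun y hy => ?_).trans
    (Finset.sum_le_sum_of_subset_of_nonneg (Finset.subset_univ _) fun _ _ _ => by positivity)
  exact pow_le_pow_of_le_one h0 h1 (Finset.mem_filter.1 hy).2

/-- Some fibre of `f` has more than `B` points, so it does not fit in the ball around any of its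
members. -/
theorem exists_hammingDist_lt_of_card_lt {ι α κ : Type*} [Fintype ι] [DecidableEq ι] [Fintype α]
    [DecidableEq α] [Fintype κ] [DecidableEq κ] (f : (ι → α) → κ) {r B : ℕ}
    (hB : ∀ x : ι → α, (Finset.univ.filter fun y => hammingDist x y ≤ r).card ≤ B)
    (hc : Fintype.card κ * B < Fintype.card α ^ Fintype.card ι) :
    ∃ x y, f x = f y ∧ r < hammingDist x y := by
  obtain ⟨c, -, hlt⟩ := Finset.exists_lt_card_fiber_of_mul_lt_card_of_maps_to
    (s := (Finset.univ : Finset (ι → α))) (t := Finset.univ) (f := f) (n := B)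
    (fun _ _ => Finset.mem_univ _) (by simpa using hc)
  obtain ⟨x, hx⟩ := Finset.card_pos.1 (lt_of_le_of_lt (Nat.zero_le _) hlt)
  by_contra! hcon
  refine absurd ((Finset.card_le_card ?_).trans (hB x)) (not_le.2 hlt)
  intro y hy
  simp only [Finset.mem_filter, Finset.mem_univ, true_and] at hx hy ⊢
  exact hcon x y (hx.trans hy.symm)

theorem abs_dotProduct_le {ι : Type*} [Fintype ι] {J : ℕ} {v w : ι → ℤ} (hv : ∀ i, |v i| ≤ J)
    (hw : ∀ i, |w i| ≤ J) : |v ⬝ᵥ w| ≤ (Fintype.card ι * J ^ 2 : ℕ) := by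
  refine (Finset.abs_sum_le_sum_abs _ _).trans ?_
  have : ∀ i ∈ Finset.univ, |v i * w i| ≤ (J : ℤ) ^ 2 := fun i _ => by
    rw [abs_mul, sq]
    exact mul_le_mul (hv i) (hw i) (abs_nonneg _) (by positivity)
  refine (Finset.sum_le_card_nsmul _ _ _ this).trans ?_
  simp

/-- Pairwise orthogonal differences of grid points, each taken within one cell of a partition
of the grid into few cells and with many nonzero coordinates. -/
theorem exists_orthogonal_differences {n J : ℕ} {κ : Type*} [Fintype κ] [DecidableEq κ]
    (g : (Fin n → Fin J) → κ) {r B k : ℕ}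
    (hB : ∀ x : Fin n → Fin J, (Finset.univ.filter fun y => hammingDist x y ≤ r).card ≤ B)
    (hc : Fintype.card κ * (2 * (n * J ^ 2) + 1) ^ k * B < J ^ n) (j : ℕ) (hj : j ≤ k) :
    ∃ z : Fin j → Fin n → ℤ, (Pairwise fun a b => z a ⬝ᵥ z b = 0) ∧
      ∀ a, ∃ x y, g x = g y ∧ r < hammingDist x y ∧
        z a = fun i => ((x i : ℕ) : ℤ) - ((y i : ℕ) : ℤ) := by
  induction j with
  | zero => exact ⟨Fin.elim0, fun a => a.elim0, fun a => a.elim0⟩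
  | succ j ih =>
    obtain ⟨z, hz, hz'⟩ := ih (by omega)
    have hzJ : ∀ a i, |z a i| ≤ J := by
      intro a i
      obtain ⟨x, y, -, -, h⟩ := hz' a
      rw [h, abs_le]
      have := (x i).2
      have := (y i).2
      constructor <;> simp <;> omega
    set M : ℕ := n * J ^ 2 with hM
    have hmem : ∀ (x : Fin n → Fin J) a,
        (fun i => ((x i : ℕ) : ℤ)) ⬝ᵥ z a ∈ Finset.Icc (-(M : ℤ)) M := by
      intro x a
      rw [Finset.mem_Icc, ← abs_le]
      have := abs_dotProduct_le (J := J) (v := fun i => ((x i : ℕ) : ℤ)) (w := z a)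
        (fun i => by rw [abs_le]; have := (x i).2; constructor <;> simp) (hzJ a)
      simpa [hM] using this
    -- Points with equal `f` lie in one cell and have equal products with every `z a`, so their
    -- difference is orthogonal to all earlier ones. Integrality leaves only 2M + 1 values per
    -- product.
    let f : (Fin n → Fin J) → κ × (Fin j → Finset.Icc (-(M : ℤ)) M) :=
      fun x => (g x, fun a => ⟨_, hmem x a⟩)
    have hcard : Fintype.card (Finset.Icc (-(M : ℤ)) M) = 2 * M + 1 := by
      rw [Fintype.card_coe, Int.card_Icc]
      omega
    obtain ⟨x, y, hxy, hr⟩ := exists_hammingDist_lt_of_card_lt f hB (by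
      rw [Fintype.card_prod, Fintype.card_fun, hcard]
      simp only [Fintype.card_fin]
      refine lt_of_le_of_lt ?_ hc
      gcongr <;> omega)
    have hxg : g x = g y := congrArg Prod.fst hxy
    have horth : ∀ a, (fun i => ((x i : ℕ) : ℤ) - ((y i : ℕ) : ℤ)) ⬝ᵥ z a = 0 := by
      intro a
      have h1 := congrArg (fun p => ((p.2 a : Finset.Icc (-(M : ℤ)) M) : ℤ)) hxy
      have h2 : (fun i => ((x i : ℕ) : ℤ) - ((y i : ℕ) : ℤ)) =
          (fun i => ((x i : ℕ) : ℤ)) - fun i => ((y i : ℕ) : ℤ) := rfl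
      rw [h2, sub_dotProduct, sub_eq_zero]
      exact h1
    refine ⟨Fin.snoc z fun i => ((x i : ℕ) : ℤ) - ((y i : ℕ) : ℤ), ?_, ?_⟩
    · intro a b hab
      induction a using Fin.lastCases with
      | last =>
        induction b using Fin.lastCases with
        | last => exact absurd rfl hab
        | cast b => simpa using horth b
      | cast a =>
        induction b using Fin.lastCases with
        | last => rw [dotProduct_comm]; simpa using horth a
        | cast b =>
          simp only [Fin.snoc_castSucc]
          exact hz fun h => hab (by rw [h])
    · intro a
      induction a using Fin.lastCases with
      | last => exact ⟨x, y, hxg, hr, by simp⟩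
      | cast a => simpa using hz' a

/-! ### Randomized rounding: the unit cube has ADL at most n. -/

/-- The points of `ℝⁿ` with all coordinates in `[0, 1]`. -/
def unitCube (n : ℕ) : Set (Euc n) := {v | ∀ i, v i ∈ Set.Icc (0 : ℝ) 1}

/-- Randomized rounding of a number to `0` or `1`. -/
noncomputable def roundBit (t : ℝ) (ω : unitInterval) : ℝ := if (ω : ℝ) < t then 1 else 0

theorem measurable_roundBit (t : ℝ) : Measurable (roundBit t) :=
  Measurable.ite (measurableSet_lt measurable_subtype_coe measurable_const) measurable_const
    measurable_const

theorem roundBit_mem_Icc (t : ℝ) (ω : unitInterval) : roundBit t ω ∈ Set.Icc (0 : ℝ) 1 := by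
  unfold roundBit
  split_ifs <;> simp

theorem memLp_roundBit (t : ℝ) (p : ℝ≥0∞) : MemLp (roundBit t) p volume :=
  MemLp.of_bound (measurable_roundBit t).aestronglyMeasurable 1 (Filter.Eventually.of_forall
    fun ω => by
      have := roundBit_mem_Icc t ω
      rw [Real.norm_eq_abs, abs_of_nonneg this.1]
      exact this.2)

theorem integral_roundBit {t : ℝ} (ht : t ∈ Set.Icc (0 : ℝ) 1) :
    ∫ ω, roundBit t ω = t := by
  have h : roundBit t = Set.indicator (Set.Iio (⟨t, ht⟩ : unitInterval)) (fun _ => (1 : ℝ)) := by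
    ext ω
    simp only [roundBit, Set.indicator, Set.mem_Iio]
    rfl
  rw [h, integral_indicator measurableSet_Iio, setIntegral_const, Measure.real,
    unitInterval.volume_Iio]
  simp [ht.1]

theorem variance_roundBit_le (t : ℝ) : ProbabilityTheory.variance (roundBit t) volume ≤ 1 := by
  refine (ProbabilityTheory.variance_le_sq_of_bounded
    (Filter.Eventually.of_forall (roundBit_mem_Icc t))
    (measurable_roundBit t).aemeasurable).trans ?_
  norm_num

/-- Coordinatewise independent randomized rounding. -/
noncomputable def roundVec {n : ℕ} (v : Euc n) (ω : Fin n → unitInterval) : Euc n :=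
  WithLp.toLp 2 fun i => roundBit (v i) (ω i)

theorem integrable_roundVec {n : ℕ} (v : Euc n) :
    Integrable (roundVec v) (Measure.pi fun _ => volume) := by
  refine (PiLp.continuousLinearEquiv 2 ℝ (fun _ : Fin n => ℝ)).symm.toContinuousLinearMap
    |>.integrable_comp (φ := fun (ω : Fin n → unitInterval) i => roundBit (v i) (ω i)) ?_
  refine Integrable.of_eval fun i => ?_
  exact integrable_comp_eval (μ := fun _ : Fin n => (volume : Measure unitInterval))
    (i := i) (memLp_one_iff_integrable.1 (memLp_roundBit (v i) 1))

theorem integral_roundVec {n : ℕ} {v : Euc n} (hv : v ∈ unitCube n) :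
    ∫ ω, roundVec v ω ∂(Measure.pi fun _ => volume) = v := by
  ext i
  have h := (EuclideanSpace.proj (𝕜 := ℝ) i : Euc n →L[ℝ] ℝ).integral_comp_comm
    (integrable_roundVec v)
  have h2 := integral_comp_eval (μ := fun _ : Fin n => (volume : Measure unitInterval)) (i := i)
    (f := roundBit (v i)) (measurable_roundBit _).aestronglyMeasurable
  exact h.symm.trans (h2.trans (integral_roundBit (hv i)))

/-- By independence the variance of ⟨u, rounding⟩ is a sum of terms uᵢ² times a variance at most 1,
hence at most |u|² = 1. -/
theorem lintegral_inner_roundVec_le {n : ℕ} {v : Euc n} (hv : v ∈ unitCube n) {u : Euc n}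
    (hu : ‖u‖ = 1) :
    ∫⁻ ω, ENNReal.ofReal (inner ℝ u (roundVec v ω - v) ^ 2) ∂(Measure.pi fun _ => volume) ≤ 1 := by
  set X : Fin n → unitInterval → ℝ := fun i ω => u i * roundBit (v i) ω with hX
  have hXm : ∀ i, MemLp (X i) 2 volume := fun i => (memLp_roundBit (v i) 2).const_mul _
  have hvar := ProbabilityTheory.variance_sum_pi hXm
  have hmem : MemLp (∑ i, fun ω : Fin n → unitInterval => X i (ω i)) 2
      (Measure.pi fun _ => volume) := by
    refine memLp_finsetSum' _ fun i _ => ?_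
    exact (hXm i).comp_measurePreserving (measurePreserving_eval _ i)
  have hsum : ∀ ω : Fin n → unitInterval,
      (∑ i, fun ω : Fin n → unitInterval => X i (ω i)) ω = inner ℝ u (roundVec v ω) := by
    intro ω
    simp [hX, roundVec, PiLp.inner_apply, mul_comm]
  have hmean : ∫ ω, (∑ i, fun ω : Fin n → unitInterval => X i (ω i)) ω
      ∂(Measure.pi fun _ => volume) = inner ℝ u v := by
    simp_rw [hsum]
    rw [integral_inner (integrable_roundVec v), integral_roundVec hv]
  have hle : ProbabilityTheory.variance (∑ i, fun ω : Fin n → unitInterval => X i (ω i))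
      (Measure.pi fun _ => volume) ≤ 1 := by
    rw [hvar]
    have hu2 : ∑ i, u i ^ 2 = 1 := by
      rw [← EuclideanSpace.real_norm_sq_eq, hu, one_pow]
    rw [← hu2]
    refine Finset.sum_le_sum fun i _ => ?_
    rw [hX, ProbabilityTheory.variance_const_mul]
    exact mul_le_of_le_one_right (sq_nonneg _) (variance_roundBit_le _)
  have := ProbabilityTheory.ofReal_variance hmem
  rw [ProbabilityTheory.evariance_eq_lintegral_ofReal, hmean] at this
  simp_rw [hsum] at this
  simp_rw [inner_sub_right]
  rw [← this]
  simpa using ENNReal.ofReal_le_ofReal hle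

/-- The vector with `0`-`1` coordinates written in a bit string. -/
noncomputable def bitVec (n : ℕ) (w : List Bool) : Euc n :=
  WithLp.toLp 2 fun i => if w.getD i false then 1 else 0

theorem bitVec_ofFn {n : ℕ} (v : Euc n) (ω : Fin n → unitInterval) :
    bitVec n (List.ofFn fun i => decide ((ω i : ℝ) < v i)) = roundVec v ω := by
  ext i
  simp [bitVec, roundVec, roundBit]

theorem hasADL_unitCube (n : ℕ) : HasADL (pointClass (unitCube n)) (fun _ => n) := by
  intro m A _ 𝒟
  -- Members are constant on `A`, so encoding the value at one point suffices.
  obtain ⟨x₀, -⟩ := 𝒟.support_nonempty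
  have hmem : ∀ h : restrictClass (pointClass (unitCube n)) A,
      ∃ v ∈ unitCube n, (h : A → Euc n) = fun _ => v := by
    rintro ⟨_, _, ⟨v, hv, rfl⟩, rfl⟩
    exact ⟨v, hv, rfl⟩
  refine ⟨{
    Ω := Fin n → unitInterval
    μ := Measure.pi fun _ => volume
    isProb := inferInstance
    enc := fun ω h => List.ofFn fun i => decide ((ω i : ℝ) < (h : A → Euc n) x₀ i)
    dec := fun w _ => bitVec n w
    enc_measurable := ?_
    estimator := ?_
    length_le := ?_ }⟩
  · intro h w
    have hfin : Measurable fun ω : Fin n → unitInterval =>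
        fun i => decide ((ω i : ℝ) < (h : A → Euc n) x₀ i) := by
      refine measurable_pi_lambda _ fun i => ?_
      refine measurable_to_bool ?_
      have : (fun ω : Fin n → unitInterval => decide ((ω i : ℝ) < (h : A → Euc n) x₀ i)) ⁻¹'
          {true} = {ω | (ω i : ℝ) < (h : A → Euc n) x₀ i} := by
        ext ω
        simp
      rw [this]
      exact measurableSet_lt (measurable_subtype_coe.comp (measurable_pi_apply i))
        measurable_const
    exact hfin (MeasurableSet.of_discrete (s := {b : Fin n → Bool | List.ofFn b = w}))
  · intro h
    obtain ⟨v, hv, hhv⟩ := hmem h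
    simp only [hhv, bitVec_ofFn]
    refine ⟨fun _ => integrable_roundVec v, fun _ => integral_roundVec hv, fun u hu => ?_⟩
    calc _ ≤ ∑' x, 𝒟 x * 1 :=
          ENNReal.tsum_le_tsum fun x => mul_le_mul_right (lintegral_inner_roundVec_le hv hu) _
      _ ≤ _ := by
        simp only [mul_one, one_pow, ENNReal.ofReal_one, 𝒟.tsum_coe]
        exact le_rfl
  · intro h
    simp

/-! ### Lower bound on the ADL of a box. -/

/-- A compressor admits, for every member and every finite family of directions, a single short
code word whose decoding has small error in all these directions simultaneously. -/
theorem Compressor.exists_short_code {X ι : Type} [Fintype ι] [Nonempty ι] {n : ℕ} {b : ℝ≥0}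
    {H : Set (X → Euc n)} {x₀ : X} (K : Compressor 1 b H (PMF.pure x₀)) {d : ℕ} (hd : 0 < d)
    (hb : b ≤ d) (h : H) (u : ι → Euc n) (hu : ∀ i, ‖u i‖ = 1) :
    ∃ w : List Bool, w.length ≤ 2 * d ∧
      ∑ i, inner ℝ (u i) (K.dec w x₀ - (h : X → Euc n) x₀) ^ 2 ≤ 2 * (Fintype.card ι : ℝ) := by
  let := K.mΩ
  have := K.isProb
  set k := Fintype.card ι with hk
  have hk0 : 0 < k := Fintype.card_pos
  set e : ι → K.Ω → ℝ := fun i ω => inner ℝ (u i) (K.dec (K.enc ω h) x₀ - (h : X → Euc n) x₀) ^ 2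
    with he
  have hint := (K.estimator h).integrable x₀
  have hem : ∀ i, AEMeasurable (fun ω => ENNReal.ofReal (e i ω)) K.μ := fun i =>
    ((((hint.aestronglyMeasurable.sub aestronglyMeasurable_const).const_inner
      (𝕜 := ℝ) (c := u i)).aemeasurable).pow_const 2).ennreal_ofReal
  have hei : ∀ i, ∫⁻ ω, ENNReal.ofReal (e i ω) ∂K.μ ≤ 1 := by
    intro i
    have h1 := (K.estimator h).error_le (u i) (hu i)
    rw [one_pow, ENNReal.ofReal_one] at h1
    refine le_trans ?_ h1
    refine le_trans ?_ (ENNReal.le_tsum x₀)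
    simp [he]
  have hlm : Measurable fun ω => ((K.enc ω h).length : ℝ≥0∞) := by
    let : MeasurableSpace (List Bool) := ⊤
    have hE : Measurable fun ω => K.enc ω h :=
      measurable_to_countable' fun w => K.enc_measurable h w
    exact (measurable_from_top (f := fun w : List Bool => (w.length : ℝ≥0∞))).comp hE
  have hl : ∫⁻ ω, ((K.enc ω h).length : ℝ≥0∞) ∂K.μ ≤ d :=
    (K.length_le h).trans (by exact_mod_cast hb)
  -- The weights k and d give both terms mean at most kd. An outcome with weighted sum at most 2kd
  -- bounds length and total error at once, since both terms are nonnegative.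
  obtain ⟨ω, hω⟩ := exists_le_lintegral (μ := K.μ)
    (f := fun ω => (k : ℝ≥0∞) * ((K.enc ω h).length : ℝ≥0∞) +
      d * ∑ i, ENNReal.ofReal (e i ω))
    ((hlm.const_mul _).aemeasurable.add
      ((Finset.aemeasurable_fun_sum _ fun i _ => hem i).const_mul _))
  have htot : (k : ℝ≥0∞) * ((K.enc ω h).length : ℝ≥0∞) + d * ∑ i, ENNReal.ofReal (e i ω) ≤
      ((2 * k * d : ℕ) : ℝ≥0∞) := by
    refine hω.trans ?_
    rw [lintegral_add_left (hlm.const_mul _), lintegral_const_mul _ hlm,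
      lintegral_const_mul'' _ (Finset.aemeasurable_fun_sum _ fun i _ => hem i),
      lintegral_finsetSum' _ fun i _ => hem i]
    calc _ ≤ (k : ℝ≥0∞) * d + d * ∑ _i : ι, 1 := by
          gcongr with i
          exact hei i
      _ = _ := by
          simp only [Finset.sum_const, Finset.card_univ, ← hk]
          push_cast
          simp only [nsmul_eq_mul, mul_one]
          ring
  have he0 : ∀ i, 0 ≤ e i ω := fun i => sq_nonneg _
  rw [← ENNReal.ofReal_sum_of_nonneg fun i _ => he0 i, ← ENNReal.ofReal_natCast,
    ← ENNReal.ofReal_natCast, ← ENNReal.ofReal_natCast, ← ENNReal.ofReal_natCast,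
    ← ENNReal.ofReal_mul (by positivity), ← ENNReal.ofReal_mul (by positivity),
    ← ENNReal.ofReal_add (by positivity) (mul_nonneg (by positivity)
      (Finset.sum_nonneg fun i _ => he0 i)),
    ENNReal.ofReal_le_ofReal_iff (by positivity)] at htot
  push_cast at htot
  have hkR : (0 : ℝ) < k := by exact_mod_cast hk0
  have hdR : (0 : ℝ) < d := by exact_mod_cast hd
  have hs0 : 0 ≤ ∑ i, e i ω := Finset.sum_nonneg fun i _ => he0 i
  refine ⟨K.enc ω h, ?_, ?_⟩
  · have : (k : ℝ) * (K.enc ω h).length ≤ k * (2 * d) := by nlinarith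
    exact_mod_cast le_of_mul_le_mul_left this hkR
  · have : (d : ℝ) * ∑ i, e i ω ≤ d * (2 * k) := by
      have : 0 ≤ (k : ℝ) * (K.enc ω h).length := by positivity
      nlinarith
    exact le_of_mul_le_mul_left this hdR

theorem card_lists_length_le (m : ℕ) :
    ∃ W : Finset (List Bool), (∀ w, w.length ≤ m → w ∈ W) ∧ W.card ≤ 2 ^ (m + 1) := by
  refine ⟨(Finset.range (m + 1)).biUnion fun l =>
    (Finset.univ : Finset (Fin l → Bool)).image List.ofFn, ?_, ?_⟩
  · intro w hw
    refine Finset.mem_biUnion.2 ⟨w.length, Finset.mem_range.2 (by omega), ?_⟩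
    exact Finset.mem_image.2 ⟨w.get, Finset.mem_univ _, List.ofFn_get w⟩
  · refine Finset.card_biUnion_le.trans ?_
    calc _ ≤ ∑ l ∈ Finset.range (m + 1), 2 ^ l := Finset.sum_le_sum fun l _ =>
          Finset.card_image_le.trans (by simp)
      _ ≤ _ := (Nat.geomSum_lt le_rfl fun l hl => Finset.mem_range.1 hl).le

/-- Codes of length at most `2d` cannot describe all sign patterns of length `16d` up to
Hamming distance `d`. -/
theorem exists_hammingDist_lt_of_short_codes {d : ℕ} (hd : 0 < d)
    (P : List Bool → Fin (16 * d) → Bool) :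
    ∃ s, ∀ w : List Bool, w.length ≤ 2 * d → d < hammingDist (P w) s := by
  by_contra! hcon
  obtain ⟨W, hW, hWc⟩ := card_lists_length_le (2 * d)
  have hball : ∀ x : Fin (16 * d) → Bool,
      (Finset.univ.filter fun y => hammingDist x y ≤ d).card ≤ 2 ^ (8 * d) := by
    intro x
    -- With t = 1/4, (5/4)^16 ≤ 2^8/4 bounds the ball by 2^(8d).
    have h := card_hammingBall_mul_pow_le x (t := 1 / 4) (by norm_num) (by norm_num) d
    simp only [Fintype.card_bool, Fintype.card_fin] at h
    rw [pow_mul] at h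
    have h2 : ((1 + (((2 : ℕ) : ℝ) - 1) * (1 / 4)) ^ 16) ^ d ≤ (2 ^ 8 : ℝ) ^ d * (1 / 4) ^ d := by
      rw [← mul_pow]
      exact pow_le_pow_left₀ (by norm_num) (by norm_num) _
    have h3 := le_of_mul_le_mul_right (h.trans h2) (by positivity)
    rw [← pow_mul] at h3
    exact_mod_cast h3
  have hcov : (Finset.univ : Finset (Fin (16 * d) → Bool)) ⊆
      W.biUnion fun w => Finset.univ.filter fun y => hammingDist (P w) y ≤ d := by
    intro s _
    obtain ⟨w, hw, hws⟩ := hcon s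
    simp only [Finset.mem_biUnion, Finset.mem_filter, Finset.mem_univ, true_and]
    exact ⟨w, hW w hw, hws⟩
  have h1 := (Finset.card_le_card hcov).trans (Finset.card_biUnion_le_card_mul _ _ _
    fun w _ => hball (P w))
  have h2 : 2 ^ (16 * d) ≤ 2 ^ (2 * d + 1) * 2 ^ (8 * d) := by
    simpa using h1.trans (Nat.mul_le_mul_right _ hWc)
  rw [← pow_add, Nat.pow_le_pow_iff_right (by norm_num)] at h2
  omega

/-- The sign `±1` of a bit. -/
noncomputable def bitSign (b : Bool) : ℝ := if b then 1 else -1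

/-- The vertices `c ± w₁ ± ⋯ ± w_k` of a parallelepiped. -/
noncomputable def parVertex {n k : ℕ} (c : Euc n) (w : Fin k → Euc n) (s : Fin k → Bool) : Euc n :=
  c + ∑ i, bitSign (s i) • w i

/-- A box with `16d` orthogonal directions, all of large Euclidean length, has approximate
description length at least `d`. -/
theorem le_ADL_parVertex {n d : ℕ} (hd : 0 < d) (c : Euc n) (w : Fin (16 * d) → Euc n)
    (horth : Pairwise fun i j => inner ℝ (w i) (w j) = 0) (hw : ∀ i, 32 ≤ ‖w i‖ ^ 2) :
    (d : ℝ≥0∞) ≤ ADL (pointClass (Set.range (parVertex c w))) := by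
  refine le_iInf₂ fun b hb => ?_
  by_contra! hbd
  have hbd' : b ≤ d := by exact_mod_cast hbd.le
  obtain ⟨K⟩ := hb 1 Finset.univ (by simp) (PMF.pure ⟨(), Finset.mem_univ _⟩)
  have : Nonempty (Fin (16 * d)) := ⟨⟨0, by omega⟩⟩
  have hw0 : ∀ i, 0 < ‖w i‖ := fun i => by
    by_contra! h
    have := le_antisymm h (norm_nonneg _)
    have := hw i
    simp_all
    linarith
  let x₀ : (Finset.univ : Finset Unit) := ⟨(), Finset.mem_univ _⟩
  let P : List Bool → Fin (16 * d) → Bool := fun l i =>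
    decide (0 < inner ℝ (w i) (K.dec l x₀ - c))
  obtain ⟨s, hs⟩ := exists_hammingDist_lt_of_short_codes hd P
  have hmem : (fun _ => parVertex c w s) ∈
      restrictClass (pointClass (Set.range (parVertex c w))) (Finset.univ : Finset Unit) :=
    ⟨_, ⟨_, ⟨s, rfl⟩, rfl⟩, rfl⟩
  obtain ⟨l, hl, herr⟩ := K.exists_short_code hd hbd' ⟨_, hmem⟩
    (fun i => (‖w i‖⁻¹ : ℝ) • w i) (fun i => by
      rw [norm_smul, norm_inv, norm_norm, inv_mul_cancel₀ (hw0 i).ne'])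
  refine absurd (hs l hl) (not_lt.2 ?_)
  have hinner : ∀ i, inner ℝ (w i) (∑ j, bitSign (s j) • w j) = bitSign (s i) * ‖w i‖ ^ 2 := by
    intro i
    rw [inner_sum, Finset.sum_eq_single i]
    · rw [real_inner_smul_right, real_inner_self_eq_norm_sq]
    · intro j _ hj
      rw [real_inner_smul_right, horth hj.symm, mul_zero]
    · simp
  have hwrong : ∀ i, P l i ≠ s i →
      32 ≤ inner ℝ ((‖w i‖⁻¹ : ℝ) • w i) (K.dec l x₀ - parVertex c w s) ^ 2 := by
    intro i hi
    have h1 : inner ℝ (w i) (K.dec l x₀ - parVertex c w s) =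
        inner ℝ (w i) (K.dec l x₀ - c) - bitSign (s i) * ‖w i‖ ^ 2 := by
      rw [← hinner, ← inner_sub_right, parVertex, sub_sub]
    rw [real_inner_smul_left, h1, mul_pow, inv_pow]
    have hpos : 0 < ‖w i‖ ^ 2 := by have := hw0 i; positivity
    refine (hw i).trans ?_
    rw [inv_mul_eq_div, le_div_iff₀ hpos, ← sq]
    change decide (0 < inner ℝ (w i) (K.dec l x₀ - c)) ≠ s i at hi
    generalize inner ℝ (w i) (K.dec l x₀ - c) = t at hi ⊢
    -- A wrong sign puts `t` and ±‖w i‖² on opposite sides of 0 (or `t` at 0), so they differ by at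
    -- least ‖w i‖².
    cases hsi : s i <;> simp [hsi, bitSign] at hi ⊢ <;> nlinarith
  -- Each wrong sign costs at least 32 and the total error is at most 2·16d, so at most d signs are
  -- wrong.
  have h32 : (32 : ℝ) * hammingDist (P l) s ≤ 2 * (16 * d : ℕ) := by
    have h2 := herr
    rw [Fintype.card_fin] at h2
    refine le_trans ?_ h2
    rw [hammingDist, mul_comm, ← nsmul_eq_mul]
    refine (Finset.card_nsmul_le_sum _ _ _ fun i hi => hwrong i (Finset.mem_filter.1 hi).2).trans
      (Finset.sum_le_sum_of_subset_of_nonneg (Finset.subset_univ _) fun _ _ _ => sq_nonneg _)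
  push_cast at h32
  have : (hammingDist (P l) s : ℝ) ≤ d := by linarith
  exact_mod_cast this

/-! ### Covering numbers of point classes and boxes. -/

theorem ADL_le_of_hasADL {X : Type} {n : ℕ} {H : Set (X → Euc n)} {b : ℝ≥0}
    (h : HasADL H fun _ => b) : ADL H ≤ b :=
  iInf₂_le b h

theorem log₂_le_of_le {N : ℕ∞} {M : ℕ} (hM : 1 ≤ M) (h : N ≤ M) :
    log₂ N ≤ ((Real.logb 2 M : ℝ) : EReal) := by
  obtain ⟨N', rfl⟩ := ENat.ne_top_iff_exists.1 (ne_top_of_le_ne_top (ENat.natCast_ne_top M) h)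
  rw [Nat.cast_le] at h
  change ((Real.logb 2 (N' : ℝ) : ℝ) : EReal) ≤ _
  rw [EReal.coe_le_coe_iff]
  rcases Nat.eq_zero_or_pos N' with rfl | hN
  · simpa using Real.logb_nonneg one_lt_two (by exact_mod_cast hM)
  · exact Real.logb_le_logb_of_le one_lt_two (by exact_mod_cast hN) (by exact_mod_cast h)

/-- A point class is covered as soon as the set is covered in the sense of metric spaces. -/
theorem coveringNumber_pointClass_le {n : ℕ} (L : Seminorm ℝ (Euc n)) (S : Set (Euc n)) {ε : ℝ}
    (T : Set (Euc n)) {M : ℕ} (hT : T.encard ≤ M)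
    (hcov : ∀ v ∈ S, ∃ g ∈ T, L (v - g) ≤ ε) : coveringNumber L (pointClass S) 1 ε ≤ M := by
  refine sInf_le fun A hA => ⟨(fun g _ => g) '' T, (Set.encard_image_le _ _).trans hT, ?_⟩
  rintro _ ⟨v, hv, rfl⟩
  obtain ⟨g, hg, hvg⟩ := hcov v hv
  refine ⟨_, ⟨g, hg, rfl⟩, ?_⟩
  rcases A.eq_empty_or_nonempty with rfl | hne
  -- For empty `A` the mean is 0/0 = 0.
  · simp [sq_nonneg]
  · have : A.card = 1 := le_antisymm hA hne.card_pos
    simp only [Finset.sum_const, this]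
    simpa using pow_le_pow_left₀ (apply_nonneg L _) hvg 2

theorem exists_cover_of_log₂_coveringNumber_le {n : ℕ} (L : Seminorm ℝ (Euc n)) (S : Set (Euc n))
    {ε : ℝ} (hε : 0 < ε) {c : ℕ}
    (h : log₂ (coveringNumber L (pointClass S) 1 ε) ≤ ((c : ℝ) : EReal)) :
    ∃ T : Finset (Euc n), T.card ≤ 2 ^ c ∧ ∀ v ∈ S, ∃ g ∈ T, L (v - g) ≤ ε := by
  have hne : coveringNumber L (pointClass S) 1 ε ≠ ⊤ := by
    intro htop
    rw [htop] at h
    exact absurd h (not_le.2 (EReal.coe_lt_top _))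
  obtain ⟨N, hN⟩ := ENat.ne_top_iff_exists.1 hne
  have hN2 : N ≤ 2 ^ c := by
    rw [← hN] at h
    change ((Real.logb 2 (N : ℝ) : ℝ) : EReal) ≤ _ at h
    rw [EReal.coe_le_coe_iff] at h
    rcases Nat.eq_zero_or_pos N with rfl | hN0
    · positivity
    · rw [Real.logb_le_iff_le_rpow one_lt_two (by exact_mod_cast hN0), Real.rpow_natCast] at h
      exact_mod_cast h
  have hmem := csInf_mem (s := {N : ℕ∞ | ∀ A : Finset Unit, A.card ≤ 1 →
    ∃ T : Set (Unit → Euc n), T.encard ≤ N ∧ ∀ h ∈ pointClass S, ∃ g ∈ T,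
      (∑ x ∈ A, L (h x - g x) ^ 2) / (A.card : ℝ) ≤ ε ^ 2}) (by
    refine ⟨⊤, fun A _ => ⟨Set.univ, le_top, fun h _ => ⟨h, Set.mem_univ _, ?_⟩⟩⟩
    simp [sq_nonneg])
  change coveringNumber L (pointClass S) 1 ε ∈ _ at hmem
  obtain ⟨T, hT, hcov⟩ := hmem Finset.univ (by simp)
  rw [← hN] at hT
  have hfin : T.Finite := Set.finite_of_encard_le_coe hT
  classical
  refine ⟨hfin.toFinset.image fun g => g (), Finset.card_image_le.trans (le_trans ?_ hN2), ?_⟩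
  · rw [hfin.encard_eq_coe_toFinset_card] at hT
    exact_mod_cast hT
  · intro v hv
    obtain ⟨g, hg, hvg⟩ := hcov (fun _ => v) ⟨v, hv, rfl⟩
    refine ⟨g (), Finset.mem_image.2 ⟨g, hfin.mem_toFinset.2 hg, rfl⟩, ?_⟩
    simp only [Finset.univ_unique, Finset.sum_singleton, Finset.card_singleton, Nat.cast_one,
      div_one] at hvg
    exact le_of_sq_le_sq hvg hε.le

theorem Seminorm.sum_bitSign_smul_le {n k : ℕ} (L : Seminorm ℝ (Euc n)) (w : Fin k → Euc n)
    {r : ℝ} (hw : ∀ i, L (w i) ≤ r) (s : Fin k → Bool) :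
    L (∑ i, bitSign (s i) • w i) ≤ k * r := by
  refine (Finset.le_sum_of_subadditive L (map_zero L).le (map_add_le_add L) _ _).trans ?_
  refine (Finset.sum_le_card_nsmul _ _ r fun i _ => ?_).trans (by simp)
  rw [map_smul_eq_mul]
  have : ‖bitSign (s i)‖ = 1 := by cases s i <;> simp [bitSign]
  rw [this, one_mul]
  exact hw i

/-- A box of small radius has small covering numbers. -/
theorem log₂_coveringNumber_parVertex_le {n k : ℕ} (hk : 0 < k) (L : Seminorm ℝ (Euc n)) (c : Euc n)
    (w : Fin k → Euc n) (hw : ∀ i, L (w i) * k * √k ≤ 1) {ε : ℝ} (hε : 0 < ε) :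
    log₂ (coveringNumber L (pointClass (Set.range (parVertex c w))) 1 ε) ≤
      ((1 / ε ^ 2 : ℝ) : EReal) := by
  have hkR : (0 : ℝ) < k := by exact_mod_cast hk
  have hsq : 0 < √(k : ℝ) := Real.sqrt_pos.2 hkR
  rcases le_or_gt 1 (ε * √k) with h | h
  · refine (log₂_le_of_le (M := 1) le_rfl (coveringNumber_pointClass_le L _ {c} (by simp) ?_)).trans
      ?_
    · rintro _ ⟨s, rfl⟩
      refine ⟨c, rfl, ?_⟩
      rw [parVertex, add_sub_cancel_left]
      refine (L.sum_bitSign_smul_le w (r := ε / k) (fun i => ?_) s).trans (by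
        rw [mul_div_cancel₀ _ hkR.ne'])
      rw [le_div_iff₀ hkR]
      exact le_of_mul_le_mul_right ((hw i).trans h) hsq
    · rw [EReal.coe_le_coe_iff]
      simp only [Nat.cast_one, Real.logb_one]
      positivity
  · refine (log₂_le_of_le (M := 2 ^ k) Nat.one_le_two_pow (coveringNumber_pointClass_le L _
      (Set.range (parVertex c w)) ?_ ?_)).trans ?_
    · rw [← Set.image_univ]
      refine (Set.encard_image_le _ _).trans ?_
      simp [Set.encard_univ]
    · intro v hv
      exact ⟨v, hv, by simp [hε.le]⟩
    · rw [EReal.coe_le_coe_iff]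
      push_cast
      rw [Real.logb_pow, Real.logb_self_eq_one one_lt_two, mul_one, le_div_iff₀ (by positivity)]
      have h0 : 0 < ε * √k := by positivity
      have : (ε * √k) ^ 2 ≤ 1 := by nlinarith
      rw [mul_pow, Real.sq_sqrt hkR.le] at this
      linarith

/-! ### Parameters, and orthogonal vectors short in L. -/

-- The second bound makes the box edges long enough; the third keeps the pigeonhole cost of 16d
-- orthogonality constraints below 2^n.
open Filter in
theorem eventually_growth (J : ℕ) : ∃ d₀ : ℕ, ∀ d : ℕ, d₀ ≤ d →
    4 ≤ d ∧ 2 ^ 20 * J ^ 2 ≤ d ∧ (2 * (d ^ 4 * J ^ 2) + 1) ^ (16 * d) ≤ 2 ^ d ^ 4 := by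
  have h1 := tendsto_pow_const_div_const_pow_of_one_lt 4 (r := (2 : ℝ)) one_lt_two
  have hpos : (0 : ℝ) < 1 / (2 * J ^ 2 + 1) := by positivity
  obtain ⟨d₁, hd₁⟩ := eventually_atTop.1 (h1.eventually (gt_mem_nhds hpos))
  refine ⟨max d₁ (max 4 (2 ^ 20 * J ^ 2)), fun d hd => ?_⟩
  have h4 : 4 ≤ d := by omega
  refine ⟨h4, by omega, ?_⟩
  have h2 := hd₁ d (by omega)
  rw [div_lt_div_iff₀ (by positivity) (by positivity), one_mul] at h2
  have h3 : d ^ 4 * (2 * J ^ 2 + 1) < 2 ^ d := by exact_mod_cast h2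
  have h5 : 1 ≤ d ^ 4 := Nat.one_le_pow _ _ (by omega)
  calc (2 * (d ^ 4 * J ^ 2) + 1) ^ (16 * d) ≤ (2 ^ d) ^ (16 * d) :=
        Nat.pow_le_pow_left (by nlinarith) _
    _ = 2 ^ (d * (16 * d)) := by rw [← pow_mul]
    _ ≤ 2 ^ d ^ 4 := Nat.pow_le_pow_right (by norm_num) (by
        have : 16 ≤ d ^ 2 := by nlinarith
        calc d * (16 * d) = 16 * d ^ 2 := by ring
          _ ≤ d ^ 2 * d ^ 2 := Nat.mul_le_mul_right _ this
          _ = d ^ 4 := by ring)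

/-- The weight t = 1/Q² makes the generating factor at most 2. Up to 2^n, the ball is then at most
the square root of the grid. -/
theorem card_hammingBall_half_le {n Q : ℕ} (hQ : 0 < Q) (x : Fin n → Fin (Q ^ 2)) :
    (Finset.univ.filter fun y => hammingDist x y ≤ n / 2).card ≤ 2 ^ n * Q ^ n := by
  have hQR : (1 : ℝ) ≤ Q := by exact_mod_cast hQ
  have hQ2 : (1 : ℝ) ≤ (Q : ℝ) ^ 2 := one_le_pow₀ hQR
  have h := card_hammingBall_mul_pow_le x (t := 1 / (Q : ℝ) ^ 2) (by positivity)
    (by rw [div_le_one (by positivity)]; exact hQ2) (n / 2)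
  simp only [Fintype.card_fin, Nat.cast_pow] at h
  rw [div_pow, one_pow, mul_one_div, div_le_iff₀ (by positivity), ← pow_mul] at h
  have h2 : (1 + ((Q : ℝ) ^ 2 - 1) * (1 / (Q : ℝ) ^ 2)) ^ n ≤ 2 ^ n := by
    refine pow_le_pow_left₀ ?_ ?_ n
    · have : 0 ≤ ((Q : ℝ) ^ 2 - 1) * (1 / (Q : ℝ) ^ 2) :=
        mul_nonneg (by linarith) (by positivity)
      linarith
    · rw [mul_one_div, ← le_sub_iff_add_le', div_le_iff₀ (by positivity)]
      linarith
  have h3 : (Q : ℝ) ^ (2 * (n / 2)) ≤ Q ^ n := pow_le_pow_right₀ hQR (Nat.mul_div_le n 2)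
  have h4 := h.trans (mul_le_mul h2 h3 (by positivity) (by positivity))
  exact_mod_cast h4

/-- The Euclidean vector with given integer coordinates. -/
noncomputable def intVec {n : ℕ} (z : Fin n → ℤ) : Euc n := WithLp.toLp 2 fun i => (z i : ℝ)

theorem inner_intVec {n : ℕ} (z w : Fin n → ℤ) :
    inner ℝ (intVec z) (intVec w) = ((z ⬝ᵥ w : ℤ) : ℝ) := by
  simp [intVec, PiLp.inner_apply, dotProduct, mul_comm]

/-- If the unit cube is covered by few `L`-balls of radius `1`, then there are many pairwise
orthogonal integer vectors with bounded coordinates, long in the Euclidean norm and short in `L`. -/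
theorem exists_orthogonal_intVec {n Q k m : ℕ} (hn : 0 < n) (hQ : Q = 2 ^ (m + 3))
    (hk : (2 * (n * (Q ^ 2) ^ 2) + 1) ^ k ≤ 2 ^ n) (L : Seminorm ℝ (Euc n))
    (T : Finset (Euc n)) (hT : T.card ≤ 2 ^ (m * n))
    (hcov : ∀ v ∈ unitCube n, ∃ g ∈ T, L (v - g) ≤ 1) :
    ∃ z : Fin k → Fin n → ℤ, (Pairwise fun a b => z a ⬝ᵥ z b = 0) ∧
      (∀ a i, |z a i| ≤ (Q ^ 2 : ℕ)) ∧ (∀ a, (n : ℤ) ≤ 2 * (z a ⬝ᵥ z a)) ∧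
      ∀ a, L (intVec (z a)) ≤ 2 * (Q ^ 2 : ℕ) := by
  classical
  have hQ0 : 0 < Q := by rw [hQ]; positivity
  set J := Q ^ 2 with hJ
  have hJ0 : (0 : ℝ) < J := by rw [hJ]; exact_mod_cast pow_pos hQ0 2
  let pt : (Fin n → Fin J) → Euc n := fun x => WithLp.toLp 2 fun i => ((x i : ℕ) : ℝ) / J
  have hpt : ∀ x, pt x ∈ unitCube n := by
    intro x i
    refine ⟨by positivity, ?_⟩
    change ((x i : ℕ) : ℝ) / J ≤ 1
    rw [div_le_one hJ0]
    exact_mod_cast (x i).2.le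
  choose g hgT hg using fun x => hcov (pt x) (hpt x)
  obtain ⟨z, hz, hz'⟩ := exists_orthogonal_differences (κ := T) (r := n / 2) (k := k)
    (fun x => ⟨g x, hgT x⟩) (card_hammingBall_half_le hQ0) (by
      rw [Fintype.card_coe]
      -- The exponent m + 3 in `Q` leaves three factors 2^n: one for orthogonality, one for the
      -- Hamming ball, one for strictness.
      calc T.card * (2 * (n * J ^ 2) + 1) ^ k * (2 ^ n * Q ^ n)
          ≤ 2 ^ (m * n) * 2 ^ n * (2 ^ n * Q ^ n) := by gcongr
        _ = 2 ^ (m * n + n + n) * Q ^ n := by rw [pow_add, pow_add]; ring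
        _ < 2 ^ ((m + 3) * n) * Q ^ n := by
            refine Nat.mul_lt_mul_of_pos_right (Nat.pow_lt_pow_right (by norm_num) ?_)
              (pow_pos hQ0 n)
            nlinarith
        _ = (Q ^ 2) ^ n := by rw [pow_mul, ← hQ, ← pow_mul, two_mul, pow_add]) k le_rfl
  refine ⟨z, hz, ?_, ?_, ?_⟩
  · intro a i
    obtain ⟨x, y, -, -, h⟩ := hz' a
    rw [h, abs_le]
    have := (x i).2
    have := (y i).2
    constructor <;> dsimp only <;> omega
  · intro a
    obtain ⟨x, y, -, hr, h⟩ := hz' a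
    have h1 : ((hammingDist x y : ℕ) : ℤ) ≤ z a ⬝ᵥ z a := by
      rw [hammingDist, Finset.card_filter, Nat.cast_sum, dotProduct]
      refine Finset.sum_le_sum fun i _ => ?_
      have hzi : z a i = ((x i : ℕ) : ℤ) - ((y i : ℕ) : ℤ) := by rw [h]
      split_ifs with hne
      · have : z a i ≠ 0 := by
          rw [hzi]
          intro h0
          exact hne (Fin.ext (by omega))
        have : 0 < z a i * z a i := mul_self_pos.2 this
        push_cast
        omega
      · push_cast
        exact mul_self_nonneg _
    omega
  · intro a
    obtain ⟨x, y, hxy, -, h⟩ := hz' a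
    have hgxy : g x = g y := congrArg Subtype.val hxy
    have h1 : intVec (z a) = (J : ℝ) • ((pt x - g x) - (pt y - g y)) := by
      rw [hgxy, sub_sub_sub_cancel_right]
      ext i
      simp only [intVec, h, pt, PiLp.smul_apply, PiLp.sub_apply, smul_eq_mul]
      field_simp
      push_cast
      ring
    rw [h1, map_smul_eq_mul, Real.norm_of_nonneg hJ0.le, mul_comm]
    refine mul_le_mul_of_nonneg_right ?_ hJ0.le
    calc _ ≤ L (pt x - g x) + L (pt y - g y) := map_sub_le_add L _ _
      _ ≤ 2 := by linarith [hg x, hg y]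

/-! ### Assembly of the box. -/

theorem parVertex_mem_unitCube {n k : ℕ} (w : Fin k → Euc n) {r : ℝ} (hr : k * r ≤ 1 / 2)
    (hw : ∀ i a, |w i a| ≤ r) (s : Fin k → Bool) :
    parVertex (WithLp.toLp 2 fun _ => 1 / 2) w s ∈ unitCube n := by
  intro a
  have h1 : parVertex (WithLp.toLp 2 fun _ => 1 / 2) w s a =
      1 / 2 + ∑ i, bitSign (s i) * w i a := by
    simp [parVertex]
  have h2 : |∑ i, bitSign (s i) * w i a| ≤ k * r := by
    refine (Finset.abs_sum_le_sum_abs _ _).trans ?_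
    refine (Finset.sum_le_card_nsmul _ _ r fun i _ => ?_).trans (by simp)
    have : |bitSign (s i)| = 1 := by cases s i <;> simp [bitSign]
    rw [abs_mul, this, one_mul]
    exact hw i a
  rw [h1]
  have h3 := abs_le.1 (h2.trans hr)
  constructor <;> linarith

theorem theorem6 (C : ℝ) :
    ∃ d₀ : ℕ, ∀ d : ℕ, d₀ ≤ d →
      ∀ L : Seminorm ℝ (Euc (d ^ 4)), (∀ v, L v = 0 → v = 0) →
        (∀ (X : Type) (H : Set (X → Euc (d ^ 4))) (a : ℝ≥0), ADL H = a →
          ∀ (m : ℕ) (ε : ℝ), 0 < ε → ε ≤ 1 →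
            log₂ (coveringNumber L H m ε) ≤ ((C * a / ε ^ 2 : ℝ) : EReal)) →
        ∃ S : Set (Euc (d ^ 4)),
          (∀ v ∈ S, ∀ i, v i ∈ Set.Icc (0 : ℝ) 1) ∧
          (∀ ε : ℝ, 0 < ε →
            log₂ (coveringNumber L (pointClass S) 1 ε) ≤ ((1 / ε ^ 2 : ℝ) : EReal)) ∧
          (d : ℝ≥0∞) ≤ ADL (pointClass S) := by
  obtain ⟨m, hm⟩ := exists_nat_ge |C|
  obtain ⟨Q, hQ⟩ : ∃ Q : ℕ, Q = 2 ^ (m + 3) := ⟨_, rfl⟩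
  obtain ⟨d₀, hd₀⟩ := eventually_growth (Q ^ 2)
  refine ⟨d₀, fun d hd L _ hL => ?_⟩
  obtain ⟨hd4, hdJ, hdk⟩ := hd₀ d hd
  have hd0 : 0 < d := by omega
  have hlog : log₂ (coveringNumber L (pointClass (unitCube (d ^ 4))) 1 1) ≤
      (((m * d ^ 4 : ℕ) : ℝ) : EReal) := by
    have hle := ADL_le_of_hasADL (hasADL_unitCube (d ^ 4))
    obtain ⟨a, ha⟩ := WithTop.ne_top_iff_exists.1 (ne_top_of_le_ne_top ENNReal.coe_ne_top hle)
    change (a : ℝ≥0∞) = _ at ha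
    refine (hL Unit _ a ha.symm 1 1 one_pos le_rfl).trans ?_
    rw [EReal.coe_le_coe_iff, one_pow, div_one, Nat.cast_mul]
    rw [← ha, ENNReal.coe_le_coe] at hle
    have hle' : (a : ℝ) ≤ (d ^ 4 : ℕ) := by exact_mod_cast hle
    exact mul_le_mul ((le_abs_self C).trans hm) hle' a.2 (Nat.cast_nonneg m)
  obtain ⟨T, hT, hcov⟩ := exists_cover_of_log₂_coveringNumber_le L _ one_pos hlog
  obtain ⟨z, horth, hzJ, hzn, hzL⟩ := exists_orthogonal_intVec (by positivity) hQ hdk L T hT hcov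
  have hJ1 : 1 ≤ Q ^ 2 := Nat.one_le_pow _ _ (by rw [hQ]; positivity)
  generalize Q ^ 2 = J at *
  have hJR : (0 : ℝ) < J := by exact_mod_cast hJ1
  have hdR : (0 : ℝ) < d := by exact_mod_cast hd0
  obtain ⟨k, hk⟩ : ∃ k : ℝ, k = (16 * d : ℕ) := ⟨_, rfl⟩
  have hk1 : 1 ≤ k := by rw [hk]; exact_mod_cast (by omega : 1 ≤ 16 * d)
  have hk0 : 0 < k := by linarith
  have hs1 : 1 ≤ √k := Real.one_le_sqrt.2 hk1
  have hs0 : 0 < √k := by linarith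
  -- Since L(z) ≤ 2J, this scaling makes L(βz)·k√k ≤ 1.
  obtain ⟨β, hβ⟩ : ∃ β : ℝ, β = 1 / (2 * J * k * √k) := ⟨_, rfl⟩
  have hβ0 : 0 < β := by rw [hβ]; positivity
  refine ⟨Set.range (parVertex (WithLp.toLp 2 fun _ => 1 / 2) fun i => β • intVec (z i)), ?_, ?_, ?_⟩
  · rintro _ ⟨s, rfl⟩
    refine parVertex_mem_unitCube _ (r := β * J) ?_ (fun i a => ?_) s
    · rw [← hk, hβ]
      have : k * (1 / (2 * J * k * √k) * J) = 1 / (2 * √k) := by field_simp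
      rw [this]
      gcongr
      linarith
    · change |β * (z i a : ℝ)| ≤ _
      rw [abs_mul, abs_of_pos hβ0]
      gcongr
      exact_mod_cast hzJ i a
  · intro ε hε
    refine log₂_coveringNumber_parVertex_le (by omega) L _ _ (fun i => ?_) hε
    rw [map_smul_eq_mul, Real.norm_of_nonneg hβ0.le, ← hk]
    calc β * L (intVec (z i)) * k * √k ≤ β * (2 * J) * k * √k := by gcongr; exact hzL i
      _ = 1 := by rw [hβ]; field_simp
  · refine le_ADL_parVertex hd0 _ _ (fun i j hij => ?_) fun i => ?_
    · beta_reduce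
      rw [real_inner_smul_left, real_inner_smul_right, inner_intVec, horth hij]
      simp
    · have h1 : (d : ℝ) ^ 4 ≤ 2 * ‖intVec (z i)‖ ^ 2 := by
        rw [← real_inner_self_eq_norm_sq, inner_intVec]
        exact_mod_cast hzn i
      -- Here 4J²k³ = 2^14 J²d³, so with |z|² ≥ d⁴/2 the bound 32 needs exactly d ≥ 2^20 J².
      have h2 : β ^ 2 = 1 / (2 ^ 14 * J ^ 2 * d ^ 3) := by
        rw [hβ, div_pow, mul_pow, Real.sq_sqrt hk0.le, hk]
        push_cast
        congr 1 <;> ring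
      have h3 : (2 : ℝ) ^ 20 * J ^ 2 ≤ d := by exact_mod_cast hdJ
      rw [norm_smul, mul_pow, Real.norm_of_nonneg hβ0.le, h2, one_div, inv_mul_eq_div,
        le_div_iff₀ (by positivity)]
      have h4 : (2 : ℝ) ^ 20 * J ^ 2 * d ^ 3 ≤ d * d ^ 3 := by gcongr
      have h5 : (d : ℝ) * d ^ 3 = d ^ 4 := by ring
      nlinarith
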